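/- **Theorem (Neighborhood diversity).** *Setting.* Let $G$ be an undirected graph without self-loops on the node set $[k]=\{1,\dots,k\}$, and let $\nu_v\in\{0,1\}^k$ be the characteristic vector of the neighborhood $N(v)$ of node $v$, and $e_v\in\{0,1\}^k$ that of $\{v\}$. Nodes $u,v$ are *false twins* if they are not adjacent and $N(u)=N(v)$, and *true twins* if they are adjacent and $N(u)\cup\{u\}=N(v)\cup\{v\}$; they are *twins* if they are false or true twins. The *neighborhood diversity* of $G$ is the least $d$ such that the nodes of $G$ can be partitioned into $d$ nonempty sets, in each of which all nodes are twins of one another. In the quantum NIH (number-in-hand) network model there is one player per node $v\in[k]$, whose input is $\nu_v$. Each player sends to a referee a quantum state that depends only on its own input (without shared randomness or shared entanglement), and the referee measures the received product state and outputs a value. The communication cost is the total number of qubits sent. The protocol is *bounded-error* for a graph parameter if on every graph $G$ it outputs the correct value with probability at least $2/3$. A *modified equality query* $\mathrm{MEQ}_{k,k}(i,j,y,z)$, with $i,j\in[k]$ and $y,z\in\{0,1\}^k$, asks whether $x_i\oplus y=x_j\oplus z$, where $x_1,\dots,x_k\in\{0,1\}^k$ are the inputs. An $\mathrm{MEQ}_{k,k}$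 decision tree is a binary tree whose inner nodes are labelled by such queries and whose leaves are labelled by output values. *Claim.* 1. For every graph $G$ on $[k]$ and all nodes $v\ne w$: $v,w$ are false twins if and only if $\nu_v=\nu_w$, and they are true twins if and only if $\nu_v\oplus e_v=\nu_w\oplus e_w$. 2. There is a constant $C>0$ such that for every $k\ge 0$ the following hold. (a) There is an $\mathrm{MEQ}_{k,k}$ decision tree of depth $2\binom{k}{2}$, each of whose queries is of the form $\mathrm{MEQ}_{k,k}(v,w,0^k,0^k)$ or $\mathrm{MEQ}_{k,k}(v,w,e_v,e_w)$ with $v\neq w$, that outputs the neighborhood diversity of $G$ on the inputs $\nu_1,\dots,\nu_k$, for every graph $G$ on $[k]$. (b) There is a bounded-error quantum protocol in the NIH network model that computes the neighborhood diversity of graphs on $[k]$ with communication cost at most $C\,k\log^2 k$ (for $k=0$ the bound is read as $0$). -/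

import Mathlib

namespace QNIH

/-! ### Bit strings and modified equality queries -/

/-- Bitwise exclusive or of two `n`-bit strings. -/
def bitXor {n : ℕ} (x y : Fin n → Bool) : Fin n → Bool := fun u => xor (x u) (y u)

/-- The string `0^n`. -/
def zeroStr (n : ℕ) : Fin n → Bool := fun _ => false

/-- The characteristic vector `e_v` of the singleton `{v}`. -/
def unitStr {n : ℕ} (v : Fin n) : Fin n → Bool := fun u => decide (u = v)

/-- A modified equality query: two player indices and two known strings. -/
structure MEQQuery (k n : ℕ) where
  i : Fin k
  j : Fin k
  y : Fin n → Bool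
  z : Fin n → Bool

/-- The query asks whether `x_i ⊕ y = x_j ⊕ z`. -/
def MEQQuery.Holds {k n : ℕ} (Q : MEQQuery k n) (x : Fin k → Fin n → Bool) : Prop :=
  bitXor (x Q.i) Q.y = bitXor (x Q.j) Q.z

instance {k n : ℕ} (Q : MEQQuery k n) (x : Fin k → Fin n → Bool) : Decidable (Q.Holds x) :=
  inferInstanceAs (Decidable (bitXor (x Q.i) Q.y = bitXor (x Q.j) Q.z))

/-- Decision trees over modified equality queries, with leaves labelled by elements of `S`.
In `node Q l r` the left child `l` is taken when the query fails, the right child `r` when it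
holds. -/
inductive MEQTree (k n : ℕ) (S : Type) : Type
  | leaf (s : S) : MEQTree k n S
  | node (Q : MEQQuery k n) (l r : MEQTree k n S) : MEQTree k n S

namespace MEQTree

variable {k n : ℕ} {S : Type}

/-- The label of the leaf that is reached on input `x`. -/
def eval : MEQTree k n S → (Fin k → Fin n → Bool) → S
  | leaf s, _ => s
  | node Q l r, x => if Q.Holds x then r.eval x else l.eval x

/-- The largest number of queries on a path from the root to a leaf. -/
def depth : MEQTree k n S → ℕ
  | leaf _ => 0
  | node _ l r => max l.depth r.depth + 1

/-- The set of the queries that label the inner nodes. -/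
def queries : MEQTree k n S → Set (MEQQuery k n)
  | leaf _ => ∅
  | node Q l r => {Q} ∪ (l.queries ∪ r.queries)

end MEQTree

/-! ### Quantum simultaneous message-passing protocols -/

/-- A pure state of a quantum register whose computational basis is indexed by `d`. -/
structure PureState (d : Type) [Fintype d] where
  amp : d → ℂ
  normalized : ∑ a, ‖amp a‖ ^ 2 = 1

/-- The product (unentangled) state of several registers. -/
def PureState.tensor {k : ℕ} {d : Fin k → Type} [∀ v, Fintype (d v)]
    (ψ : ∀ v, PureState (d v)) : PureState (∀ v, d v) where
  amp a := ∏ v, (ψ v).amp (a v)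
  normalized := by
    classical
    have h : ∑ a : (∀ v, d v), ‖∏ v, (ψ v).amp (a v)‖ ^ 2
        = ∏ v, ∑ b, ‖(ψ v).amp b‖ ^ 2 := by
      rw [Fintype.prod_sum]
      refine Finset.sum_congr rfl fun a _ => ?_
      rw [norm_prod, Finset.prod_pow]
    rw [h]
    exact Finset.prod_eq_one fun v _ => (ψ v).normalized

open scoped ComplexOrder in
/-- A general quantum measurement (positive operator-valued measure) with finitely many
outcomes. -/
structure Measurement (d Ω : Type) [Fintype d] [DecidableEq d] [Fintype Ω] where
  effect : Ω → Matrix d d ℂ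
  posSemidef : ∀ ω, (effect ω).PosSemidef
  sum_effect : ∑ ω, effect ω = 1

/-- The probability `⟨ψ|E_ω|ψ⟩` of the outcome `ω` in the state `ψ`. -/
def Measurement.prob {d Ω : Type} [Fintype d] [DecidableEq d] [Fintype Ω]
    (M : Measurement d Ω) (ψ : PureState d) (ω : Ω) : ℝ :=
  (star ψ.amp ⬝ᵥ (M.effect ω).mulVec ψ.amp).re

/-- A quantum simultaneous message-passing protocol with `k` players, inputs in `X` and outputs
in `S`. Player `v` sends a state of `qubits v` qubits that depends only on its own input; there
is neither shared randomness nor shared entanglement, so the referee holds the product of the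
messages. The referee measures it and computes the output from the outcome. -/
structure QuantumSMP (k : ℕ) (X S : Type) where
  qubits : Fin k → ℕ
  message : ∀ v, X → PureState (Fin (2 ^ qubits v))
  numOutcomes : ℕ
  measurement : Measurement (∀ v, Fin (2 ^ qubits v)) (Fin numOutcomes)
  output : Fin numOutcomes → S

namespace QuantumSMP

variable {k : ℕ} {X S : Type}

/-- The communication cost: the total number of qubits sent to the referee. -/
def cost (P : QuantumSMP k X S) : ℕ := ∑ v, P.qubits v

open scoped Classical in
/-- The probability that the referee outputs `s` when the inputs are `x`. -/
noncomputable def outputProb (P : QuantumSMP k X S) (x : Fin k → X) (s : S) : ℝ :=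
  ∑ ω, if P.output ω = s then
    P.measurement.prob (PureState.tensor fun v => P.message v (x v)) ω else 0

end QuantumSMP

/-! ### Graphs, twins and neighborhood diversity -/

open scoped Classical in
/-- The neighborhood vectors: `nu G v` is the characteristic vector of the set of neighbors
of `v`. In the number-in-hand network model it is the input of player `v`. -/
noncomputable def nu {k : ℕ} (G : SimpleGraph (Fin k)) (v : Fin k) : Fin k → Bool :=
  fun u => decide (G.Adj v u)

/-- A quantum protocol in the number-in-hand network model on `k` nodes. -/
abbrev NIHProtocol (k : ℕ) (S : Type) := QuantumSMP k (Fin k → Bool) S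

/-- `P` is a bounded-error protocol for the graph parameter `f`. -/
def NIHProtocol.ComputesBoundedError {k : ℕ} {S : Type} (P : NIHProtocol k S)
    (f : SimpleGraph (Fin k) → S) : Prop :=
  ∀ G : SimpleGraph (Fin k), 2 / 3 ≤ QuantumSMP.outputProb P (nu G) (f G)

/-- False twins: not adjacent, with the same neighborhood. -/
def FalseTwins {V : Type} (G : SimpleGraph V) (u v : V) : Prop :=
  ¬ G.Adj u v ∧ G.neighborSet u = G.neighborSet v

/-- True twins: adjacent, with the same closed neighborhood. -/
def TrueTwins {V : Type} (G : SimpleGraph V) (u v : V) : Prop :=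
  G.Adj u v ∧ G.neighborSet u ∪ {u} = G.neighborSet v ∪ {v}

/-- Twins: false twins or true twins. Every node is (trivially) a false twin of itself. -/
def Twins {V : Type} (G : SimpleGraph V) (u v : V) : Prop :=
  FalseTwins G u v ∨ TrueTwins G u v

/-- The nodes of `G` can be partitioned into `d` nonempty sets, each consisting of nodes that
are twins of one another. -/
def HasTwinPartition {V : Type} [Fintype V] [DecidableEq V] (G : SimpleGraph V) (d : ℕ) : Prop :=
  ∃ P : Finpartition (Finset.univ : Finset V),
    P.parts.card = d ∧ ∀ s ∈ P.parts, ∀ u ∈ s, ∀ v ∈ s, Twins G u v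

/-- The neighborhood diversity: the least size of a partition into sets of twins. -/
noncomputable def neighborhoodDiversity {V : Type} [Fintype V] [DecidableEq V]
    (G : SimpleGraph V) : ℕ :=
  sInf {d | HasTwinPartition G d}

/-- The infimum is over a nonempty set, and is therefore a minimum. -/
theorem neighborhoodDiversity_isLeast {V : Type} [Fintype V] [DecidableEq V]
    (G : SimpleGraph V) :
    IsLeast {d | HasTwinPartition G d} (neighborhoodDiversity G) := by
  have hne : {d | HasTwinPartition G d}.Nonempty := by
    refine ⟨_, (⊥ : Finpartition (Finset.univ : Finset V)), rfl, ?_⟩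
    intro s hs u hu v hv
    obtain ⟨a, _, rfl⟩ := Finpartition.mem_bot_iff.1 hs
    rw [Finset.mem_singleton] at hu hv
    subst hu hv
    exact Or.inl ⟨G.loopless.irrefl _, rfl⟩
  exact ⟨Nat.sInf_mem hne, fun d hd => Nat.sInf_le hd⟩

end QNIH

namespace QNIH

/-! ### Twins and modified equality queries -/

/-- The string that is added to the input of `v` to test for true (`b = true`) or false twins. -/
def twinMask {k : ℕ} (b : Bool) (v : Fin k) : Fin k → Bool :=
  if b then unitStr v else zeroStr k

/-- The query that tests whether `v` and `w` are true (`b = true`) or false twins. -/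
def twinQuery {k : ℕ} (b : Bool) (v w : Fin k) : MEQQuery k k :=
  ⟨v, w, twinMask b v, twinMask b w⟩

theorem falseTwins_iff_holds {k : ℕ} (G : SimpleGraph (Fin k)) (v w : Fin k) :
    FalseTwins G v w ↔ MEQQuery.Holds ⟨v, w, zeroStr k, zeroStr k⟩ (nu G) := by
  have key : MEQQuery.Holds ⟨v, w, zeroStr k, zeroStr k⟩ (nu G) ↔
      ∀ u, G.Adj v u ↔ G.Adj w u := by
    simp [MEQQuery.Holds, bitXor, zeroStr, nu, funext_iff]
  rw [key, FalseTwins, Set.ext_iff]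
  simp only [SimpleGraph.mem_neighborSet]
  exact ⟨fun h => h.2, fun h => ⟨fun hvw => G.irrefl ((h w).1 hvw), h⟩⟩

theorem trueTwins_iff_holds {k : ℕ} (G : SimpleGraph (Fin k)) {v w : Fin k} (hvw : v ≠ w) :
    TrueTwins G v w ↔ MEQQuery.Holds ⟨v, w, unitStr v, unitStr w⟩ (nu G) := by
  have key : MEQQuery.Holds ⟨v, w, unitStr v, unitStr w⟩ (nu G) ↔
      ∀ u, (G.Adj v u ∨ u = v) ↔ (G.Adj w u ∨ u = w) := by
    simp only [MEQQuery.Holds, bitXor, unitStr, nu, funext_iff]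
    refine forall_congr' fun u => ?_
    have hv : u = v → ¬ G.Adj v u := by rintro rfl; exact G.irrefl
    have hw : u = w → ¬ G.Adj w u := by rintro rfl; exact G.irrefl
    by_cases h1 : G.Adj v u <;> by_cases h2 : G.Adj w u <;> by_cases h3 : u = v <;>
      by_cases h4 : u = w <;> simp_all
  rw [key, TrueTwins, Set.ext_iff]
  simp only [Set.mem_union, SimpleGraph.mem_neighborSet, Set.mem_singleton_iff]
  exact ⟨fun h => h.2, fun h => ⟨((h w).2 (Or.inr rfl)).resolve_right hvw.symm, h⟩⟩

theorem FalseTwins.refl {V : Type} (G : SimpleGraph V) (v : V) : FalseTwins G v v :=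
  ⟨G.irrefl, rfl⟩

theorem Twins.symm {V : Type} {G : SimpleGraph V} {u v : V} (h : Twins G u v) : Twins G v u :=
  h.imp (fun h => ⟨fun h' => h.1 h'.symm, h.2.symm⟩) fun h => ⟨h.1.symm, h.2.symm⟩

theorem twins_iff {k : ℕ} (G : SimpleGraph (Fin k)) (v w : Fin k) :
    Twins G v w ↔ v = w ∨ ∃ b, (twinQuery b v w).Holds (nu G) := by
  rcases eq_or_ne v w with rfl | h
  · simp [Twins, FalseTwins.refl]
  · simp [Twins, falseTwins_iff_holds, trueTwins_iff_holds G h, twinQuery, twinMask, h]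

/-- The least number of parts of a partition into sets whose elements are pairwise related. -/
noncomputable def partitionNumber {V : Type} [Fintype V] [DecidableEq V] (R : V → V → Prop) : ℕ :=
  sInf {d | ∃ P : Finpartition (Finset.univ : Finset V),
    P.parts.card = d ∧ ∀ s ∈ P.parts, ∀ u ∈ s, ∀ v ∈ s, R u v}

theorem neighborhoodDiversity_eq_partitionNumber {k : ℕ} (G : SimpleGraph (Fin k))
    {R : Fin k → Fin k → Prop} (h : ∀ v w, Twins G v w ↔ R v w) :
    neighborhoodDiversity G = partitionNumber R := by
  obtain rfl : Twins G = R := by ext v w; exact h v w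
  rfl

/-! ### Nonadaptive decision trees -/

namespace MEQTree

variable {k n : ℕ} {S : Type}

/-- The tree that makes the queries of a list and applies `f` to the set of those that hold. -/
def ofList : List (MEQQuery k n) → (Set (MEQQuery k n) → S) → MEQTree k n S
  | [], f => leaf (f ∅)
  | Q :: qs, f => node Q (ofList qs f) (ofList qs fun s => f (insert Q s))

theorem depth_ofList (qs : List (MEQQuery k n)) (f : Set (MEQQuery k n) → S) :
    (ofList qs f).depth = qs.length := by
  induction qs generalizing f with
  | nil => rfl
  | cons Q qs ih => simp [ofList, depth, ih]

theorem queries_ofList (qs : List (MEQQuery k n)) (f : Set (MEQQuery k n) → S) :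
    (ofList qs f).queries = {Q | Q ∈ qs} := by
  induction qs generalizing f with
  | nil => simp [ofList, queries]
  | cons Q qs ih => ext; simp [ofList, queries, ih]

theorem eval_ofList (qs : List (MEQQuery k n)) (f : Set (MEQQuery k n) → S)
    (x : Fin k → Fin n → Bool) : (ofList qs f).eval x = f {Q | Q ∈ qs ∧ Q.Holds x} := by
  induction qs generalizing f with
  | nil => simp [ofList, eval]
  | cons Q qs ih =>
    by_cases h : Q.Holds x
    · simp only [ofList, eval, h, if_true, ih]
      congr 1
      ext R
      simp only [Set.mem_insert_iff, Set.mem_ofPred_eq, List.mem_cons]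
      grind
    · simp only [ofList, eval, h, if_false, ih]
      congr 1
      ext R
      simp only [Set.mem_ofPred_eq, List.mem_cons]
      grind

end MEQTree

theorem exists_tree_neighborhoodDiversity (k : ℕ) : ∃ T : MEQTree k k ℕ,
    T.depth = 2 * k.choose 2 ∧
    (∀ Q ∈ T.queries, Q.i ≠ Q.j ∧ ((Q.y = zeroStr k ∧ Q.z = zeroStr k) ∨
      (Q.y = unitStr Q.i ∧ Q.z = unitStr Q.j))) ∧
    ∀ G : SimpleGraph (Fin k), T.eval (nu G) = neighborhoodDiversity G := by
  classical
  let pairs : List (Fin k × Fin k) :=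
    (⊤ : SimpleGraph (Fin k)).edgeFinset.toList.map fun e => (Quot.out e)
  have hpairs : ∀ v w, v ≠ w → (v, w) ∈ pairs ∨ (w, v) ∈ pairs := by
    intro v w h
    have hmem : Quot.out s(v, w) ∈ pairs := by
      refine List.mem_map_of_mem (f := fun e : Sym2 (Fin k) => (Quot.out e)) ?_
      simpa using h
    have hout : s((Quot.out s(v, w)).1, (Quot.out s(v, w)).2) = s(v, w) := Quot.out_eq _
    generalize (Quot.out s(v, w) : Fin k × Fin k) = p at hmem hout
    obtain ⟨a, b⟩ := p
    rcases Sym2.eq_iff.1 hout with ⟨rfl, rfl⟩ | ⟨rfl, rfl⟩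
    · exact Or.inl hmem
    · exact Or.inr hmem
  have hne : ∀ p ∈ pairs, p.1 ≠ p.2 := by
    intro p hp
    obtain ⟨e, he, rfl⟩ := List.mem_map.1 hp
    have hout : s((Quot.out e).1, (Quot.out e).2) = e := Quot.out_eq _
    rw [Finset.mem_toList, ← hout, SimpleGraph.mem_edgeFinset] at he
    exact he
  have hlen : pairs.length = k.choose 2 := by
    rw [List.length_map, Finset.length_toList, SimpleGraph.card_edgeFinset_top_eq_card_choose_two,
      Fintype.card_fin]
  let qs : List (MEQQuery k k) :=
    pairs.map (fun p => twinQuery false p.1 p.2) ++ pairs.map fun p => twinQuery true p.1 p.2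
  have hqs : ∀ Q, Q ∈ qs ↔ ∃ b, ∃ p ∈ pairs, Q = twinQuery b p.1 p.2 := by
    intro Q
    simp only [qs, List.mem_append, List.mem_map, Bool.exists_bool, eq_comm]
  refine ⟨MEQTree.ofList qs fun s => partitionNumber fun v w =>
    v = w ∨ ∃ b, twinQuery b v w ∈ s ∨ twinQuery b w v ∈ s, ?_, ?_, fun G => ?_⟩
  · rw [MEQTree.depth_ofList]
    simp [qs, hlen, two_mul]
  · intro Q hQ
    rw [MEQTree.queries_ofList] at hQ
    obtain ⟨b, p, hp, rfl⟩ := (hqs Q).1 hQ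
    refine ⟨hne p hp, ?_⟩
    cases b
    · exact Or.inl ⟨rfl, rfl⟩
    · exact Or.inr ⟨rfl, rfl⟩
  · rw [MEQTree.eval_ofList]
    refine (neighborhoodDiversity_eq_partitionNumber G fun v w => ?_).symm
    constructor
    · intro h
      rcases eq_or_ne v w with hvw | hvw
      · exact Or.inl hvw
      refine Or.inr ?_
      rcases hpairs v w hvw with hp | hp
      · obtain ⟨b, hb⟩ := ((twins_iff G v w).1 h).resolve_left hvw
        exact ⟨b, Or.inl ⟨(hqs _).2 ⟨b, _, hp, rfl⟩, hb⟩⟩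
      · obtain ⟨b, hb⟩ := ((twins_iff G w v).1 h.symm).resolve_left hvw.symm
        exact ⟨b, Or.inr ⟨(hqs _).2 ⟨b, _, hp, rfl⟩, hb⟩⟩
    · rintro (rfl | ⟨b, h | h⟩)
      · exact Or.inl (FalseTwins.refl G v)
      · exact (twins_iff G v w).2 (Or.inr ⟨b, h.2⟩)
      · exact ((twins_iff G w v).2 (Or.inr ⟨b, h.2⟩)).symm

end QNIH

namespace QNIH

open scoped InnerProductSpace

/-! ### Sequential projective measurements -/

theorem norm_apply_le_of_isStarProjection {E : Type*} [NormedAddCommGroup E] [InnerProductSpace ℂ E]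
    [CompleteSpace E] {A : E →L[ℂ] E} (hA : IsStarProjection A) (x : E) : ‖A x‖ ≤ ‖x‖ := by
  have h : ‖A x‖ * ‖A x‖ ≤ ‖x‖ * ‖A x‖ := by
    rw [← inner_self_eq_norm_mul_norm (𝕜 := ℂ), ← ContinuousLinearMap.adjoint_inner_right,
      ← ContinuousLinearMap.star_eq_adjoint, hA.isSelfAdjoint.star_eq,
      ← mul_apply_eq_comp, hA.isIdempotentElem.eq]
    exact (RCLike.re_le_norm _).trans (norm_inner_le_norm _ _)
  rcases (norm_nonneg (A x)).eq_or_lt with h0 | h0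
  · rw [← h0]; exact norm_nonneg x
  · exact le_of_mul_le_mul_right h h0

/-- Measuring projections one after the other. The Kraus operator of an outcome moves a vector
at most by the sum of the distances to the predicted outcomes of the single measurements. -/
theorem exists_sequential_kraus {E : Type*} [NormedAddCommGroup E] [InnerProductSpace ℂ E]
    [CompleteSpace E] {T : ℕ} (P : Fin T → E →L[ℂ] E) (hP : ∀ t, IsStarProjection (P t)) :
    ∃ K : (Fin T → Bool) → E →L[ℂ] E, ∑ b, star (K b) * K b = 1 ∧
      ∀ b x, ‖K b x - x‖ ≤ ∑ t, ‖P t x - if b t then x else 0‖ := by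
  induction T with
  | zero => exact ⟨fun _ => 1, by simp, by simp⟩
  | succ T ih =>
    obtain ⟨K, hK, hKx⟩ := ih (fun t => P t.succ) fun t => hP t.succ
    let A : Bool → E →L[ℂ] E := fun c => if c then P 0 else 1 - P 0
    have hA : ∀ c, IsStarProjection (A c) := by
      intro c
      cases c
      · exact (hP 0).one_sub
      · exact hP 0
    have hAsum : ∑ c, star (A c) * A c = 1 := by
      simp only [(hA _).isSelfAdjoint.star_eq, (hA _).isIdempotentElem.eq]
      simp [A]
    refine ⟨fun b => A (b 0) * K (fun t => b t.succ), ?_, fun b x => ?_⟩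
    · rw [← (Fin.consEquiv fun _ => Bool).sum_comp, Fintype.sum_prod_type, Finset.sum_comm]
      simp only [Fin.consEquiv_apply, Fin.cons_zero, Fin.cons_succ, star_mul]
      rw [← hK]
      refine Finset.sum_congr rfl fun b _ => ?_
      calc ∑ c, star (K b) * star (A c) * (A c * K b)
          = star (K b) * (∑ c, star (A c) * A c) * K b := by
            simp only [Finset.mul_sum, Finset.sum_mul, mul_assoc]
        _ = star (K b) * K b := by rw [hAsum, mul_one]
    · have h1 : (A (b 0) * K (fun t => b t.succ)) x - x
          = A (b 0) (K (fun t => b t.succ) x - x) + (A (b 0) x - x) := by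
        rw [mul_apply_eq_comp, map_sub]; abel
      have h2 : ‖A (b 0) x - x‖ = ‖P 0 x - if b 0 then x else 0‖ := by
        cases b 0 <;> simp [A]
      rw [Fin.sum_univ_succ, h1, add_comm, ← h2]
      refine (norm_add_le _ _).trans (add_le_add le_rfl ?_)
      exact (norm_apply_le_of_isStarProjection (hA _) _).trans (hKx _ x)

/-- The amplitude vector as an element of the Hilbert space. -/
noncomputable def PureState.vec {d : Type} [Fintype d] (ψ : PureState d) : EuclideanSpace ℂ d :=
  WithLp.toLp 2 ψ.amp

theorem PureState.norm_vec {d : Type} [Fintype d] (ψ : PureState d) : ‖ψ.vec‖ = 1 := by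
  rw [EuclideanSpace.norm_eq, Real.sqrt_eq_one]
  exact ψ.normalized

open scoped ComplexOrder in
theorem exists_sequential_measurement {d : Type} [Fintype d] [DecidableEq d] {T : ℕ}
    (P : Fin T → Matrix d d ℂ) (hP : ∀ t, IsStarProjection (P t)) :
    ∃ M : Measurement d (Fin (Fintype.card (Fin T → Bool))), ∀ (ψ : PureState d)
      (b : Fin T → Bool) (δ : ℝ), T * δ ≤ 1 →
      (∀ t, ‖Matrix.toEuclideanCLM (𝕜 := ℂ) (P t) ψ.vec - if b t then ψ.vec else 0‖ ≤ δ) →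
      (1 - T * δ) ^ 2 ≤ M.prob ψ (Fintype.equivFin _ b) := by
  obtain ⟨K, hK, hKx⟩ := exists_sequential_kraus
    (fun t => Matrix.toEuclideanCLM (n := d) (𝕜 := ℂ) (P t)) fun t => (hP t).map _
  let Φ := Matrix.toEuclideanCLM (n := d) (𝕜 := ℂ)
  let N : (Fin T → Bool) → Matrix d d ℂ := fun b => Φ.symm (K b)
  have hΦN : ∀ b, Φ (N b) = K b := fun b => Φ.apply_symm_apply _
  refine ⟨⟨fun ω => (N ((Fintype.equivFin _).symm ω)).conjTranspose *
    N ((Fintype.equivFin _).symm ω), fun ω => Matrix.posSemidef_conjTranspose_mul_self _, ?_⟩, ?_⟩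
  · rw [(Fintype.equivFin (Fin T → Bool)).symm.sum_comp fun b => (N b).conjTranspose * N b]
    apply EquivLike.injective Φ
    rw [map_sum, map_one, ← hK]
    refine Finset.sum_congr rfl fun b _ => ?_
    rw [← Matrix.star_eq_conjTranspose, map_mul, map_star, hΦN]
  · intro ψ b δ hδ h
    have hprob : ∀ A : Matrix d d ℂ,
        (star ψ.amp ⬝ᵥ (A.conjTranspose * A).mulVec ψ.amp).re = ‖Φ A ψ.vec‖ ^ 2 := by
      intro A
      rw [← Matrix.mulVec_mulVec, Matrix.dotProduct_mulVec, Matrix.vecMul_conjTranspose, star_star,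
        @norm_sq_eq_re_inner ℂ, EuclideanSpace.inner_eq_star_dotProduct, dotProduct_comm]
      rfl
    simp only [Measurement.prob, Equiv.symm_apply_apply, hprob, hΦN]
    have h1 : ‖K b ψ.vec - ψ.vec‖ ≤ T * δ := by
      refine (hKx b _).trans ((Finset.sum_le_sum fun t _ => h t).trans ?_)
      simp
    have h2 := norm_sub_norm_le ψ.vec (K b ψ.vec)
    rw [norm_sub_rev, ψ.norm_vec] at h2
    exact pow_le_pow_left₀ (by linarith) (by linarith) 2

theorem Measurement.prob_nonneg {d Ω : Type} [Fintype d] [DecidableEq d] [Fintype Ω]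
    (M : Measurement d Ω) (ψ : PureState d) (ω : Ω) : 0 ≤ M.prob ψ ω :=
  (M.posSemidef ω).re_dotProduct_nonneg ψ.amp

theorem QuantumSMP.prob_le_outputProb {k : ℕ} {X S : Type} (P : QuantumSMP k X S) (x : Fin k → X)
    (ω : Fin P.numOutcomes) :
    P.measurement.prob (PureState.tensor fun v => P.message v (x v)) ω ≤
      P.outputProb x (P.output ω) := by
  classical
  rw [QuantumSMP.outputProb]
  refine le_trans (by simp) (Finset.single_le_sum (fun ω' _ => ?_) (Finset.mem_univ ω))
  split_ifs
  · exact P.measurement.prob_nonneg _ _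
  · exact le_rfl

/-! ### Averages over unitary representations -/

/-- The average of a finite group of operators. -/
noncomputable def groupAverage {H A : Type*} [Fintype H] [AddCommMonoid A] [Module ℂ A]
    (U : H → A) : A :=
  (Fintype.card H : ℂ)⁻¹ • ∑ h, U h

theorem isStarProjection_groupAverage {H A : Type*} [Group H] [Fintype H] [Ring A] [StarRing A]
    [Algebra ℂ A] [StarModule ℂ A] {U : H → A} (hmul : ∀ g h, U (g * h) = U g * U h)
    (hstar : ∀ h, star (U h) = U h⁻¹) : IsStarProjection (groupAverage U) := by
  have hcard : (Fintype.card H : ℂ) ≠ 0 := Nat.cast_ne_zero.2 Fintype.card_ne_zero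
  constructor
  · have h : (∑ g, U g) * ∑ h, U h = (Fintype.card H : ℂ) • ∑ h, U h := by
      rw [Finset.sum_mul]
      have : ∀ g, U g * ∑ h, U h = ∑ h, U h := fun g => by
        rw [Finset.mul_sum, ← Equiv.sum_comp (Equiv.mulLeft g) U]
        simp [hmul]
      simp [this, Nat.cast_smul_eq_nsmul]
    rw [IsIdempotentElem, groupAverage, smul_mul_smul_comm, h, smul_smul, mul_assoc,
      inv_mul_cancel₀ hcard, mul_one]
  · rw [IsSelfAdjoint, groupAverage, star_smul, star_sum]
    simp only [hstar]
    have h : ∑ h, U h⁻¹ = ∑ h, U h := Equiv.sum_comp (Equiv.inv H) U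
    simp [h]

theorem norm_sq_apply_le_of_groupAverage {H E : Type*} [Group H] [Fintype H]
    [NormedAddCommGroup E] [InnerProductSpace ℂ E] [CompleteSpace E] {U : H → E →L[ℂ] E}
    (hU : IsStarProjection (groupAverage U)) {x : E} {ε : ℝ} (hε : 0 ≤ ε)
    (h1 : ‖⟪x, U 1 x⟫_ℂ‖ ≤ 1) (hx : ∀ h, h ≠ 1 → ‖⟪x, U h x⟫_ℂ‖ ≤ ε) :
    ‖groupAverage U x‖ ^ 2 ≤ (Fintype.card H : ℝ)⁻¹ + ε := by
  classical
  have hpos : (0 : ℝ) < Fintype.card H := Nat.cast_pos.2 Fintype.card_pos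
  have hsum : ‖⟪x, groupAverage U x⟫_ℂ‖ ≤ (Fintype.card H : ℝ)⁻¹ * ∑ h, ‖⟪x, U h x⟫_ℂ‖ := by
    rw [groupAverage, smul_apply, sum_apply,
      inner_smul_right, inner_sum, norm_mul, norm_inv, Complex.norm_natCast]
    exact mul_le_mul_of_nonneg_left (norm_sum_le _ _) (inv_nonneg.2 hpos.le)
  have hle : ∑ h, ‖⟪x, U h x⟫_ℂ‖ ≤ 1 + Fintype.card H * ε := by
    rw [← Finset.add_sum_erase _ _ (Finset.mem_univ (1 : H))]
    refine add_le_add h1 ((Finset.sum_le_card_nsmul _ _ ε fun h hh =>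
      hx h (Finset.ne_of_mem_erase hh)).trans ?_)
    rw [nsmul_eq_mul]
    exact mul_le_mul_of_nonneg_right (Nat.cast_le.2 (Finset.card_le_univ _)) hε
  have hnorm : ‖groupAverage U x‖ ^ 2 ≤ ‖⟪x, groupAverage U x⟫_ℂ‖ := by
    rw [@norm_sq_eq_re_inner ℂ, ← ContinuousLinearMap.adjoint_inner_right,
      ← ContinuousLinearMap.star_eq_adjoint, hU.isSelfAdjoint.star_eq,
      ← mul_apply_eq_comp, hU.isIdempotentElem.eq]
    exact RCLike.re_le_norm _
  calc _ ≤ (Fintype.card H : ℝ)⁻¹ * ∑ h, ‖⟪x, U h x⟫_ℂ‖ := hnorm.trans hsum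
    _ ≤ (Fintype.card H : ℝ)⁻¹ * (1 + Fintype.card H * ε) :=
      mul_le_mul_of_nonneg_left hle (inv_nonneg.2 hpos.le)
    _ = _ := by field_simp

end QNIH

namespace QNIH

open scoped InnerProductSpace

/-! ### Swap tests on several copies -/

/-- Basis states of a register of labels `E a p i`, where for every copy `i` the slots `p` are
permuted by `h i`. -/
def copyPerm {D ι κ M : Type} (E : D ≃ (ι → κ → M)) (h : κ → Equiv.Perm ι) : Equiv.Perm D where
  toFun a := E.symm fun p i => E a (h i p) i
  invFun a := E.symm fun p i => E a ((h i)⁻¹ p) i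
  left_inv a := by simp
  right_inv a := by simp

theorem copyPerm_mul {D ι κ M : Type} (E : D ≃ (ι → κ → M)) (g h : κ → Equiv.Perm ι) :
    copyPerm E (g * h) = copyPerm E h * copyPerm E g := by
  ext a
  simp [copyPerm]

/-- The operator that permutes, for every copy `i`, the slots by `h i`. -/
noncomputable def copyOp {D ι κ M : Type} [DecidableEq D] (E : D ≃ (ι → κ → M))
    (h : κ → Equiv.Perm ι) : Matrix D D ℂ :=
  (copyPerm E h).permMatrix ℂ

theorem prod_amp_copyPerm {D ι κ M : Type} [Fintype ι] [Fintype κ] [Fintype M]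
    (E : D ≃ (ι → κ → M)) (h : κ → Equiv.Perm ι) (φ : ι → PureState M) (a : D) :
    ∏ p, ∏ i, (φ p).amp (E (copyPerm E h a) p i) =
      ∏ p, ∏ i, (φ ((h i)⁻¹ p)).amp (E a p i) := by
  rw [Finset.prod_comm, Finset.prod_comm (f := fun p i => (φ ((h i)⁻¹ p)).amp (E a p i))]
  refine Finset.prod_congr rfl fun i _ => ?_
  rw [← Equiv.prod_comp (h i) fun p => (φ ((h i)⁻¹ p)).amp (E a p i)]
  simp [copyPerm]

theorem toEuclideanCLM_copyOp_vec {D ι κ M : Type} [DecidableEq D] [Fintype D]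
    (E : D ≃ (ι → κ → M)) (h : κ → Equiv.Perm ι) (ψ : PureState D) :
    Matrix.toEuclideanCLM (𝕜 := ℂ) (copyOp E h) ψ.vec =
      WithLp.toLp 2 fun a => ψ.amp (copyPerm E h a) := by
  rw [PureState.vec, Matrix.toEuclideanCLM_toLp, copyOp, Matrix.permMatrix_mulVec]
  rfl

theorem inner_copyOp {D ι κ M : Type} [DecidableEq D] [Fintype D] [Fintype ι] [DecidableEq ι]
    [Fintype κ] [DecidableEq κ] [Fintype M]
    (E : D ≃ (ι → κ → M)) (h : κ → Equiv.Perm ι) (φ : ι → PureState M) (ψ : PureState D)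
    (hψ : ∀ a, ψ.amp a = ∏ p, ∏ i, (φ p).amp (E a p i)) :
    ⟪ψ.vec, Matrix.toEuclideanCLM (𝕜 := ℂ) (copyOp E h) ψ.vec⟫_ℂ =
      ∏ p, ∏ i, ⟪(φ p).vec, (φ ((h i)⁻¹ p)).vec⟫_ℂ := by
  rw [toEuclideanCLM_copyOp_vec]
  simp only [EuclideanSpace.inner_eq_star_dotProduct, PureState.vec, dotProduct, Pi.star_apply]
  simp only [Fintype.prod_sum]
  rw [← Equiv.sum_comp E]
  refine Finset.sum_congr rfl fun a _ => ?_
  simp only [hψ, prod_amp_copyPerm, star_prod, Finset.prod_mul_distrib]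

theorem norm_inner_vec_le {M : Type} [Fintype M] (φ χ : PureState M) :
    ‖⟪φ.vec, χ.vec⟫_ℂ‖ ≤ 1 := by
  simpa [PureState.norm_vec] using norm_inner_le_norm (𝕜 := ℂ) φ.vec χ.vec

theorem apply_eq_of_mem_zpowers_swap {ι : Type} [DecidableEq ι] {p p' : ι} {τ : Equiv.Perm ι}
    (hτ : τ ∈ Subgroup.zpowers (Equiv.swap p p')) : τ = 1 ∨ τ = Equiv.swap p p' := by
  obtain ⟨n, rfl⟩ := Subgroup.mem_zpowers_iff.1 hτ
  have h2 : Equiv.swap p p' ^ (2 : ℤ) = 1 := by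
    rw [zpow_ofNat, pow_two, Equiv.swap_mul_self]
  rcases Int.even_or_odd' n with ⟨m, rfl | rfl⟩
  · left; rw [zpow_mul, h2, one_zpow]
  · right; rw [zpow_add, zpow_mul, h2, one_zpow, one_mul, zpow_one]

/-- The equality test for the slots `p` and `p'`, each of which holds `r` copies of a state. -/
theorem exists_equality_test {D ι M : Type} [DecidableEq D] [Fintype D] [Fintype ι]
    [DecidableEq ι] [Fintype M] {r : ℕ} (E : D ≃ (ι → Fin r → M)) (p p' : ι) :
    ∃ P : Matrix D D ℂ, IsStarProjection P ∧ ∀ (φ : ι → PureState M) (ψ : PureState D),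
      (∀ a, ψ.amp a = ∏ q, ∏ i, (φ q).amp (E a q i)) →
      (φ p = φ p' → Matrix.toEuclideanCLM (𝕜 := ℂ) P ψ.vec = ψ.vec) ∧
      ∀ ε : ℝ, p ≠ p' → ‖⟪(φ p).vec, (φ p').vec⟫_ℂ‖ ≤ ε →
        ‖Matrix.toEuclideanCLM (𝕜 := ℂ) P ψ.vec‖ ^ 2 ≤ (2 ^ r)⁻¹ + ε := by
  classical
  let Γ := Subgroup.zpowers (Equiv.swap p p')
  have : Fintype Γ := Fintype.ofFinite _
  let U : (Fin r → Γ) → Matrix D D ℂ := fun h => copyOp E fun i => (h i : Equiv.Perm ι)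
  let Φ := Matrix.toEuclideanCLM (n := D) (𝕜 := ℂ)
  have hU : IsStarProjection (groupAverage U) := by
    refine isStarProjection_groupAverage (fun g h => ?_) fun h => ?_
    · change ((copyPerm E ((fun i => (g i : Equiv.Perm ι)) * fun i => (h i : Equiv.Perm ι))).permMatrix
        ℂ) = _
      rw [copyPerm_mul, Matrix.permMatrix_mul]
      rfl
    · rw [Matrix.star_eq_conjTranspose]
      exact Matrix.conjTranspose_permMatrix _
  have hΦ : Φ (groupAverage U) = groupAverage fun h => Φ (U h) := by
    rw [groupAverage, groupAverage, map_smul, map_sum]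
  refine ⟨groupAverage U, hU, fun φ ψ hψ => ⟨fun heq => ?_, fun ε hne hε => ?_⟩⟩
  · have hfix : ∀ h, Φ (U h) ψ.vec = ψ.vec := by
      intro h
      rw [toEuclideanCLM_copyOp_vec, PureState.vec]
      congr 1
      ext a
      rw [hψ, hψ, prod_amp_copyPerm]
      refine Finset.prod_congr rfl fun q _ => Finset.prod_congr rfl fun i _ => ?_
      suffices hφ : φ ((h i : Equiv.Perm ι)⁻¹ q) = φ q by rw [hφ]
      rcases apply_eq_of_mem_zpowers_swap (h i).2 with h1 | h1 <;> rw [h1]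
      · rfl
      · rw [Equiv.swap_inv, Equiv.swap_apply_def]
        split_ifs with h2 h3
        · rw [h2, heq]
        · rw [h3, heq]
        · rfl
    change Φ (groupAverage U) ψ.vec = ψ.vec
    rw [hΦ, groupAverage, smul_apply, sum_apply]
    simp only [hfix, Finset.sum_const, Finset.card_univ]
    rw [← Nat.cast_smul_eq_nsmul ℂ, smul_smul, inv_mul_cancel₀, one_smul]
    exact Nat.cast_ne_zero.2 Fintype.card_ne_zero
  · have hcard : Fintype.card (Fin r → Γ) = 2 ^ r := by
      have h2 : Fintype.card Γ = 2 := by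
        rw [← Nat.card_eq_fintype_card, Nat.card_zpowers]
        refine orderOf_eq_prime ?_ ?_
        · rw [pow_two, Equiv.swap_mul_self]
        · rwa [Ne, Equiv.swap_eq_one_iff]
      simp [h2]
    have hp : IsStarProjection (groupAverage fun h => Φ (U h)) := hΦ ▸ hU.map Φ
    have key := norm_sq_apply_le_of_groupAverage hp (x := ψ.vec) ((norm_nonneg _).trans hε) ?_ ?_
    · rw [hcard] at key
      change ‖Φ (groupAverage U) ψ.vec‖ ^ 2 ≤ _
      rw [hΦ]
      exact_mod_cast key
    · rw [inner_copyOp E _ φ ψ hψ, norm_prod]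
      refine Finset.prod_le_one (fun _ _ => norm_nonneg _) fun q _ => ?_
      rw [norm_prod]
      exact Finset.prod_le_one (fun _ _ => norm_nonneg _) fun i _ => norm_inner_vec_le _ _
    · intro h hh
      obtain ⟨i, hi⟩ := Function.ne_iff.1 hh
      have hi' : ((h i : Equiv.Perm ι))⁻¹ p = p' := by
        rcases apply_eq_of_mem_zpowers_swap (h i).2 with h1 | h1
        · exact absurd (Subtype.ext h1) hi
        · rw [h1, Equiv.swap_inv, Equiv.swap_apply_left]
      rw [inner_copyOp E _ φ ψ hψ, ← Fintype.prod_prod_type', norm_prod,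
        ← Finset.mul_prod_erase _ _ (Finset.mem_univ (p, i))]
      refine (mul_le_of_le_one_right (norm_nonneg _)
        (Finset.prod_le_one (fun _ _ => norm_nonneg _) fun _ _ => norm_inner_vec_le _ _)).trans ?_
      simpa only [hi'] using hε

/-! ### Fingerprints -/

/-- The polynomial whose coefficients are the bits of `x`. -/
noncomputable def bitPolynomial {k : ℕ} (F : Type) [Field F] (x : Fin k → Bool) : Polynomial F :=
  ∑ u : Fin k, Polynomial.monomial (u : ℕ) (if x u then 1 else 0)

theorem coeff_bitPolynomial {k : ℕ} (F : Type) [Field F] (x : Fin k → Bool) (u : Fin k) :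
    (bitPolynomial F x).coeff u = if x u then 1 else 0 := by
  simp [bitPolynomial, Polynomial.finsetSum_coeff, Polynomial.coeff_monomial, Fin.val_inj]

theorem degree_bitPolynomial_lt {k : ℕ} (F : Type) [Field F] (x : Fin k → Bool) :
    (bitPolynomial F x).degree < k := by
  rw [← Polynomial.mem_degreeLT]
  refine Submodule.sum_mem _ fun u _ => Polynomial.mem_degreeLT.2 ?_
  exact (Polynomial.degree_monomial_le _ _).trans_lt (Nat.cast_lt.2 u.2)

open Classical in
theorem card_eval_bitPolynomial_eq_le {k : ℕ} (F : Type) [Field F] [Fintype F]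
    {x y : Fin k → Bool} (hxy : x ≠ y) :
    (Finset.univ.filter fun t : F =>
      (bitPolynomial F x).eval t = (bitPolynomial F y).eval t).card ≤ k := by
  by_contra! hlt
  refine hxy (funext fun u => ?_)
  have h := Polynomial.eq_of_degrees_lt_of_eval_finset_eq _
    ((degree_bitPolynomial_lt F x).trans (Nat.cast_lt.2 hlt))
    ((degree_bitPolynomial_lt F y).trans (Nat.cast_lt.2 hlt))
    fun t ht => (Finset.mem_filter.1 ht).2
  have hu := congrArg (fun f => Polynomial.coeff f u) h
  simp only [coeff_bitPolynomial] at hu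
  cases hx : x u <;> cases hy : y u <;> simp_all

open Classical in
/-- The uniform superposition of the points of the graph of a polynomial. -/
noncomputable def fingerprint {k : ℕ} (F : Type) [Field F] [Fintype F] (x : Fin k → Bool) :
    PureState (F × F) where
  amp a := if (bitPolynomial F x).eval a.1 = a.2 then ((√(Fintype.card F))⁻¹ : ℝ) else 0
  normalized := by
    have h : (Fintype.card F : ℝ) ≠ 0 := Nat.cast_ne_zero.2 Fintype.card_ne_zero
    simp [Fintype.sum_prod_type, apply_ite, ite_pow, h]

theorem norm_inner_fingerprint_le {k : ℕ} (F : Type) [Field F] [Fintype F]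
    {x y : Fin k → Bool} (hxy : x ≠ y) :
    ‖⟪(fingerprint F x).vec, (fingerprint F y).vec⟫_ℂ‖ ≤ k / Fintype.card F := by
  classical
  have h : ⟪(fingerprint F x).vec, (fingerprint F y).vec⟫_ℂ =
      (((Finset.univ.filter fun t : F =>
      (bitPolynomial F x).eval t = (bitPolynomial F y).eval t).card / Fintype.card F : ℝ) : ℂ) := by
    rw [EuclideanSpace.inner_eq_star_dotProduct]
    simp only [PureState.vec, dotProduct, Pi.star_apply, fingerprint, Fintype.sum_prod_type]
    have h1 : ∀ t : F, (∑ s, (if (bitPolynomial F y).eval t = s then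
        (((√(Fintype.card F))⁻¹ : ℝ) : ℂ) else 0) * star (if (bitPolynomial F x).eval t = s then
        (((√(Fintype.card F))⁻¹ : ℝ) : ℂ) else 0)) =
        if (bitPolynomial F x).eval t = (bitPolynomial F y).eval t then
          (((Fintype.card F : ℝ)⁻¹ : ℝ) : ℂ) else 0 := by
      intro t
      simp only [ite_mul, zero_mul, Finset.sum_ite_eq, Finset.mem_univ, if_true]
      split_ifs
      · rw [Complex.star_def, Complex.conj_ofReal, ← Complex.ofReal_mul, ← mul_inv,
          Real.mul_self_sqrt (Nat.cast_nonneg _)]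
      · simp
    rw [Finset.sum_congr rfl fun t _ => h1 t, ← Finset.sum_filter, Finset.sum_const, nsmul_eq_mul]
    push_cast
    rw [div_eq_mul_inv]
  rw [h, Complex.norm_real, Real.norm_of_nonneg (by positivity)]
  exact div_le_div_of_nonneg_right (Nat.cast_le.2 (card_eval_bitPolynomial_eq_le F hxy))
    (Nat.cast_nonneg _)

end QNIH

namespace QNIH

open scoped InnerProductSpace

/-! ### The protocol -/

/-- `r` copies of each of several states, sent in a register with basis labels `e c b i`. -/
noncomputable def PureState.copies {d β M : Type} [Fintype d] [Fintype β] [DecidableEq β]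
    [Fintype M] {r : ℕ} (e : d ≃ (β → Fin r → M)) (φ : β → PureState M) : PureState d where
  amp c := ∏ b, ∏ i, (φ b).amp (e c b i)
  normalized := by
    rw [e.sum_comp fun c => ‖∏ b, ∏ i, (φ b).amp (c b i)‖ ^ 2]
    simp only [norm_prod, ← Finset.prod_pow]
    rw [← Fintype.prod_sum (f := fun b (c : Fin r → M) => ∏ i, ‖(φ b).amp (c i)‖ ^ 2)]
    refine Finset.prod_eq_one fun b _ => ?_
    rw [← Fintype.prod_sum (f := fun (_ : Fin r) a => ‖(φ b).amp a‖ ^ 2)]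
    exact Finset.prod_eq_one fun _ _ => (φ b).normalized

theorem exists_protocol_neighborhoodDiversity {k r m : ℕ} (hm : m ≠ 0) {δ : ℝ} (hδ : 0 ≤ δ)
    (hrm : (2 ^ r)⁻¹ + (k : ℝ) / 2 ^ m ≤ δ ^ 2) (hk : 2 * (k : ℝ) ^ 2 * δ ≤ 1 / 10) :
    ∃ P : NIHProtocol k ℕ, P.ComputesBoundedError neighborhoodDiversity ∧
      P.cost = k * (4 * r * m) := by
  classical
  let F := GaloisField 2 m
  have : Fintype F := Fintype.ofFinite _
  have hF : Fintype.card F = 2 ^ m := by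
    rw [← Nat.card_eq_fintype_card]; exact GaloisField.card 2 m hm
  let q := 4 * r * m
  let e : Fin (2 ^ q) ≃ (Bool → Fin r → F × F) := Fintype.equivOfCardEq <| by
    simp only [Fintype.card_fin, Fintype.card_fun, Fintype.card_prod, Fintype.card_bool, hF, q]
    ring
  let E : (∀ _ : Fin k, Fin (2 ^ q)) ≃ (Fin k × Bool → Fin r → F × F) :=
    (Equiv.piCongrRight fun _ => e).trans (Equiv.curry (Fin k) Bool (Fin r → F × F)).symm
  let eT := Fintype.equivFin (Fin k × Fin k × Bool)
  choose P hP hPt using fun t : Fin k × Fin k × Bool =>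
    exists_equality_test E (t.1, t.2.2) (t.2.1, t.2.2)
  obtain ⟨M, hM⟩ := exists_sequential_measurement (fun t => P (eT.symm t)) fun t => hP _
  let eO := Fintype.equivFin (Fin (Fintype.card (Fin k × Fin k × Bool)) → Bool)
  let Q : NIHProtocol k ℕ :=
    { qubits := fun _ => q
      message := fun v x => PureState.copies e fun b => fingerprint F (bitXor x (twinMask b v))
      numOutcomes := _
      measurement := M
      output := fun ω => partitionNumber fun v w =>
        v = w ∨ ∃ b, eO.symm ω (eT (v, w, b)) = true }
  refine ⟨Q, fun G => ?_, by simp [Q, QuantumSMP.cost, q]⟩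
  let φ : Fin k × Bool → PureState (F × F) := fun p =>
    fingerprint F (bitXor (nu G p.1) (twinMask p.2 p.1))
  let ψ : PureState (∀ _ : Fin k, Fin (2 ^ q)) := PureState.tensor fun v => Q.message v (nu G v)
  have hψ : ∀ a, ψ.amp a = ∏ p, ∏ i, (φ p).amp (E a p i) := by
    intro a
    rw [Fintype.prod_prod_type]
    rfl
  let β : Fin (Fintype.card (Fin k × Fin k × Bool)) → Bool := fun t =>
    decide ((twinQuery (eT.symm t).2.2 (eT.symm t).1 (eT.symm t).2.1).Holds (nu G))
  have hT : (Fintype.card (Fin k × Fin k × Bool) : ℝ) = 2 * (k : ℝ) ^ 2 := by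
    simp only [Fintype.card_prod, Fintype.card_fin, Fintype.card_bool]
    push_cast
    ring
  have hprob := hM ψ β δ (by rw [hT]; linarith) fun t => by
    generalize ht : eT.symm t = s
    obtain ⟨v, w, b⟩ := s
    have hβ : β t = decide ((twinQuery b v w).Holds (nu G)) := by simp only [β, ht]
    obtain ⟨heq, hne⟩ := hPt (v, w, b) φ ψ hψ
    rw [hβ]
    by_cases hQ : (twinQuery b v w).Holds (nu G)
    · have hφ : φ (v, b) = φ (w, b) := congrArg (fingerprint F) hQ
      simpa [hQ, heq hφ] using hδ
    · have hvw : v ≠ w := by rintro rfl; exact hQ rfl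
      have h := hne _ (by simpa using hvw) (norm_inner_fingerprint_le F hQ)
      rw [hF] at h
      push_cast at h
      simpa [hQ] using abs_le_of_sq_le_sq' (h.trans hrm) hδ |>.2
  have hout : Q.output (eO β) = neighborhoodDiversity G := by
    refine (neighborhoodDiversity_eq_partitionNumber G fun v w => ?_).symm
    rw [twins_iff]
    simp [β]
  have hle := Q.prob_le_outputProb (nu G) (eO β)
  rw [hout] at hle
  refine le_trans ?_ (hprob.trans hle)
  rw [hT]
  nlinarith

theorem Measurement.prob_eq_one {d Ω : Type} [Fintype d] [DecidableEq d] [Fintype Ω]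
    (M : Measurement d Ω) (ψ : PureState d) {ω : Ω} (h : M.effect ω = 1) : M.prob ψ ω = 1 := by
  rw [Measurement.prob, h, Matrix.one_mulVec, dotProduct, Complex.re_sum, ← ψ.normalized]
  refine Finset.sum_congr rfl fun a _ => ?_
  rw [Pi.star_apply, Complex.star_def, Complex.conj_mul', ← Complex.ofReal_pow, Complex.ofReal_re]

open scoped ComplexOrder in
theorem exists_protocol_of_subsingleton {k : ℕ} (hk : k ≤ 1) :
    ∃ P : NIHProtocol k ℕ, P.ComputesBoundedError neighborhoodDiversity ∧ P.cost = 0 := by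
  classical
  let Q : NIHProtocol k ℕ :=
    { qubits := fun _ => 0
      message := fun _ _ => ⟨fun _ => 1, by simp⟩
      numOutcomes := 1
      measurement := ⟨fun _ => 1, fun _ => Matrix.PosSemidef.one, by simp⟩
      output := fun _ => neighborhoodDiversity (⊥ : SimpleGraph (Fin k)) }
  refine ⟨Q, fun G => ?_, by simp [Q, QuantumSMP.cost]⟩
  have : Subsingleton (Fin k) := Fin.subsingleton_iff_le_one.2 hk
  obtain rfl : G = ⊥ := Subsingleton.elim _ _
  refine le_trans ?_ (Q.prob_le_outputProb (nu ⊥) (0 : Fin 1))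
  rw [Measurement.prob_eq_one _ _ rfl]
  norm_num

theorem natCast_clog_le {k : ℕ} (hk : 2 ≤ k) : (Nat.clog 2 k : ℝ) ≤ 3 * Real.log k := by
  have h1 : 2 ^ (Nat.clog 2 k - 1) ≤ k := (Nat.pow_pred_clog_lt_self one_lt_two hk).le
  have hlog : (Nat.clog 2 k - 1 : ℝ) * Real.log 2 ≤ Real.log k := by
    have h := Real.log_le_log (by positivity) (Nat.cast_le (α := ℝ).2 h1)
    rw [Nat.cast_pow, Real.log_pow, Nat.cast_sub (Nat.clog_pos one_lt_two hk)] at h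
    exact_mod_cast h
  have h2 : Real.log 2 ≤ Real.log k := Real.log_le_log two_pos (by exact_mod_cast hk)
  have h3 := Real.log_two_gt_d9
  nlinarith

theorem exists_protocol_cost_le (k : ℕ) : ∃ P : NIHProtocol k ℕ,
    P.ComputesBoundedError neighborhoodDiversity ∧
    (P.cost : ℝ) ≤ 7560 * (k : ℝ) * Real.log (k : ℝ) ^ 2 := by
  rcases Nat.lt_or_ge k 2 with hk | hk
  · obtain ⟨P, hP, hcost⟩ := exists_protocol_of_subsingleton (Nat.le_of_lt_succ hk)
    exact ⟨P, hP, by rw [hcost, Nat.cast_zero]; positivity⟩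
  set L := Nat.clog 2 k with hL
  have hL1 : 1 ≤ L := Nat.clog_pos one_lt_two hk
  have hkL : (k : ℝ) ≤ 2 ^ L := by exact_mod_cast Nat.le_pow_clog one_lt_two k
  have hk0 : (0 : ℝ) < k := by positivity
  have hrm : ((2 : ℝ) ^ (14 * L))⁻¹ + (k : ℝ) / 2 ^ (15 * L) ≤ (1 / (20 * (k : ℝ) ^ 2)) ^ 2 := by
    have h10 : (2 : ℝ) ^ 10 ≤ 2 ^ (10 * L) := pow_le_pow_right₀ one_le_two (by omega)
    have h4 : (k : ℝ) ^ 4 ≤ 2 ^ (4 * L) := by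
      rw [mul_comm, pow_mul]; exact pow_le_pow_left₀ hk0.le hkL 4
    have h14 : 1024 * (k : ℝ) ^ 4 ≤ 2 ^ (14 * L) := by
      calc 1024 * (k : ℝ) ^ 4 ≤ 2 ^ (10 * L) * 2 ^ (4 * L) :=
            mul_le_mul (by linarith) h4 (by positivity) (by positivity)
        _ = 2 ^ (14 * L) := by rw [← pow_add]; congr 1; ring
    have h15 : (k : ℝ) / 2 ^ (15 * L) ≤ (2 ^ (14 * L))⁻¹ := by
      rw [div_le_iff₀ (by positivity), show 15 * L = 14 * L + L by ring, pow_add,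
        inv_mul_cancel_left₀ (by positivity)]
      exact hkL
    have hinv : ((2 : ℝ) ^ (14 * L))⁻¹ ≤ (1024 * (k : ℝ) ^ 4)⁻¹ := inv_anti₀ (by positivity) h14
    calc ((2 : ℝ) ^ (14 * L))⁻¹ + (k : ℝ) / 2 ^ (15 * L)
        ≤ (1024 * (k : ℝ) ^ 4)⁻¹ + (1024 * (k : ℝ) ^ 4)⁻¹ := add_le_add hinv (h15.trans hinv)
      _ = ((k : ℝ) ^ 4)⁻¹ * (2 / 1024) := by rw [mul_inv]; ring
      _ ≤ ((k : ℝ) ^ 4)⁻¹ * (1 / 400) :=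
          mul_le_mul_of_nonneg_left (by norm_num) (by positivity)
      _ = (1 / (20 * (k : ℝ) ^ 2)) ^ 2 := by rw [div_pow, mul_pow, ← pow_mul, one_pow]; norm_num
  have hk' : 2 * (k : ℝ) ^ 2 * (1 / (20 * (k : ℝ) ^ 2)) ≤ 1 / 10 := by
    field_simp
    norm_num
  obtain ⟨P, hP, hcost⟩ :=
    exists_protocol_neighborhoodDiversity (by omega) (by positivity) hrm hk'
  refine ⟨P, hP, ?_⟩
  have h := natCast_clog_le hk
  rw [← hL] at h
  have h2 : (L : ℝ) ^ 2 ≤ (3 * Real.log k) ^ 2 := pow_le_pow_left₀ (Nat.cast_nonneg _) h 2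
  rw [hcost]
  push_cast
  nlinarith

end QNIH

theorem mainTheorem6 :
    (∀ (k : ℕ) (G : SimpleGraph (Fin k)) (v w : Fin k), v ≠ w →
      (QNIH.FalseTwins G v w ↔
        QNIH.MEQQuery.Holds ⟨v, w, QNIH.zeroStr k, QNIH.zeroStr k⟩ (QNIH.nu G)) ∧
      (QNIH.TrueTwins G v w ↔
        QNIH.MEQQuery.Holds ⟨v, w, QNIH.unitStr v, QNIH.unitStr w⟩ (QNIH.nu G))) ∧
    ∃ C : ℝ, 0 < C ∧ ∀ k : ℕ,
      ∃ (T : QNIH.MEQTree k k ℕ) (P : QNIH.NIHProtocol k ℕ),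
        T.depth = 2 * k.choose 2 ∧
        (∀ Q ∈ T.queries, Q.i ≠ Q.j ∧
          ((Q.y = QNIH.zeroStr k ∧ Q.z = QNIH.zeroStr k) ∨
            (Q.y = QNIH.unitStr Q.i ∧ Q.z = QNIH.unitStr Q.j))) ∧
        (∀ G : SimpleGraph (Fin k), T.eval (QNIH.nu G) = QNIH.neighborhoodDiversity G) ∧
        P.ComputesBoundedError QNIH.neighborhoodDiversity ∧
        (P.cost : ℝ) ≤ C * (k : ℝ) * Real.log (k : ℝ) ^ 2 := by
  refine ⟨fun k G v w hvw =>
    ⟨QNIH.falseTwins_iff_holds G v w, QNIH.trueTwins_iff_holds G hvw⟩, 7560, by norm_num,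
    fun k => ?_⟩
  obtain ⟨T, hdepth, hqueries, heval⟩ := QNIH.exists_tree_neighborhoodDiversity k
  obtain ⟨P, hP, hcost⟩ := QNIH.exists_protocol_cost_le k
  exact ⟨T, P, hdepth, hqueries, heval, hP, hcost⟩
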